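/- Let $S^0(x)=x/3$ and $S^1(x)=(x+2)/3$ be the dilations of $\mathbb{R}$ of ratio $1/3$ with fixed points $0$ and $1$, and let $s=\log 2/\log 3$. There is a unique Borel probability measure $\kappa$ on $\mathbb{R}$ (the dyadic Cantor measure) such that $$\kappa=\tfrac12\,S^0_\#\kappa+\tfrac12\,S^1_\#\kappa .$$ The measure $\kappa$ has compact support and is Ahlfors regular of dimension $s$: there is a constant $C>0$ such that $$C^{-1}r^s\le\kappa(B(x,r))\le C\,r^s$$ for all $x\in\operatorname{supp}\kappa$ and all $0\le r\le\operatorname{diam}(\operatorname{supp}\kappa)$, where $B(x,r)$ is the closed ball. Moreover, for every real $p\ge 1$, the quantity $$W_p(\kappa,\Delta_N)\,N^{1/s}$$ has no limit (finite or infinite) as $N\to\infty$. Here $\Delta_N$ is the set of all finite measures on $\mathbb{R}$ supported in at most $N$ points, $W_p(\kappa,\Delta_N)=\inf_{\nu\in\Delta_N}W_p(\kappa,\nu)$, and $W_p(\mu,\nu)=\inf_\Pi\left(\int|x-y|^p\,\Pi(\mathrm{d}x\,\mathrm{d}y)\right)^{1/p}$ is the $L^p$ Wasserstein distance, the infimum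 being over all measures $\Pi$ on $\mathbb{R}\times\mathbb{R}$ with marginals $\mu$ and $\nu$ (so that it is $+\infty$ if $\mu$ and $\nu$ have different masses). -/

import Mathlib

open MeasureTheory Filter Topology
open scoped ENNReal

/-- A transport plan between `μ` and `ν`: a Borel measure on the product space
whose marginals are `μ` and `ν`. -/
def IsTransportPlan {X : Type*} [MeasurableSpace X] (μ ν : Measure X) (P : Measure (X × X)) :
    Prop :=
  P.map Prod.fst = μ ∧ P.map Prod.snd = ν

/-- The `L^p` cost of a transport plan, with values in `[0, ∞]`. -/
noncomputable def transportCost {X : Type*} [MetricSpace X] [MeasurableSpace X] (p : ℝ)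
    (P : Measure (X × X)) : ℝ≥0∞ :=
  ∫⁻ z, edist z.1 z.2 ^ p ∂P

/-- The `L^p` Wasserstein distance, with values in `[0, ∞]`; it is `∞` when there is no transport
plan, in particular for two measures of different masses. -/
noncomputable def wasserstein {X : Type*} [MetricSpace X] [MeasurableSpace X] (p : ℝ)
    (μ ν : Measure X) : ℝ≥0∞ :=
  ⨅ (P : Measure (X × X)) (_ : IsTransportPlan μ ν P), transportCost p P ^ (1 / p)

/-- The set of all finite measures supported in at most `N` points. -/
def finSupported (X : Type*) [MeasurableSpace X] (N : ℕ) : Set (Measure X) :=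
  {ν | IsFiniteMeasure ν ∧ ∃ t : Finset X, t.card ≤ N ∧ ν (↑t : Set X)ᶜ = 0}

/-- The `L^p` Wasserstein distance from `μ` to the set of measures supported in at most
`N` points. -/
noncomputable def quantizationDist {X : Type*} [MetricSpace X] [MeasurableSpace X] (p : ℝ)
    (μ : Measure X) (N : ℕ) : ℝ≥0∞ :=
  ⨅ ν ∈ finSupported X N, wasserstein p μ ν

/-- A finite, compactly supported measure `μ` is Ahlfors regular of dimension `s ∈ (0, ∞)` if
the measure of the closed ball of radius `r` around any point of the support is comparable to
`r ^ s`, for all `r` up to the diameter of the support. -/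
def IsAhlforsRegular {X : Type*} [MetricSpace X] [MeasurableSpace X] (s : ℝ) (μ : Measure X) :
    Prop :=
  0 < s ∧ IsFiniteMeasure μ ∧ IsCompact μ.support ∧
    ∃ C : ℝ, 0 < C ∧ ∀ x ∈ μ.support, ∀ r : ℝ, 0 ≤ r → r ≤ Metric.diam μ.support →
      C⁻¹ * r ^ s ≤ μ.real (Metric.closedBall x r) ∧
        μ.real (Metric.closedBall x r) ≤ C * r ^ s

/-- The map `μ ↦ 1/2 S⁰_# μ + 1/2 S¹_# μ`, where `S⁰ x = x / 3` and `S¹ x = (x + 2) / 3` are the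
dilations of ratio `1/3` with fixed points `0` and `1`. -/
noncomputable def cantorOperator (μ : Measure ℝ) : Measure ℝ :=
  (2⁻¹ : ℝ≥0∞) • μ.map (fun x : ℝ => x / 3) +
    (2⁻¹ : ℝ≥0∞) • μ.map (fun x : ℝ => (x + 2) / 3)

/-- `κ` is a Borel probability measure fixed by the Cantor operator. -/
def IsDyadicCantorMeasure (κ : Measure ℝ) : Prop :=
  IsProbabilityMeasure κ ∧ cantorOperator κ = κ

/-! The measure is the law of a random ternary expansion with digits 0 and 2. The equation for its
characteristic function gives uniqueness, and the gap between its two halves gives regularity.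

For the last claim, let `e N` be the least mean `p`-th power of the distance to `N` points
(`quantizationDist_rpow`), and `q = p / s`. Copying a configuration into both halves gives `e (2N) ≤
3⁻ᵖ e N`, so `N ^ q * e N` does not increase under doubling. Hence a limit `l` satisfies `l ≤ N ^ q
* e N` for all `N ≥ 1`.

For a converse, two free guard points outside `[0, 1]` make the problem split exactly in the useful
direction: the guarded error `g m` is at least the mean of `3⁻ᵖ g a` and `3⁻ᵖ g b` for some `a + b ≤
m` (`guardedErr_split`). An affine minorant of `g` therefore passes to all scales
(`affine_le_guardedErr_div_pow`). Take one touching `g` at two far points `n < n'`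
(`exists_supporting_line`). Along `N = 2ᵏ(n + n')` it yields `l ≥ ((n + n') / 2) ^ q * (g n + g n')
/ 2`. Far out, `e ≤ g`, so `g n ≥ l * n ^ (-q)`, and likewise at `n'`. Strict convexity of `x ^
(-q)` then makes the right side exceed `l`, a contradiction. -/

/-! ### Existence: random ternary expansions. -/

/-- The fair coin measure on the ternary digits `0` and `2`. -/
noncomputable def digitMeasure : Measure (Fin 3) :=
  (2⁻¹ : ℝ≥0∞) • Measure.dirac 0 + (2⁻¹ : ℝ≥0∞) • Measure.dirac 2

instance : IsProbabilityMeasure digitMeasure :=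
  ⟨by simp [digitMeasure, ENNReal.inv_two_add_inv_two]⟩

/-- Prepend a digit to a sequence of digits. -/
def consDigit (d : Fin 3) (a : ℕ → Fin 3) : ℕ → Fin 3 := fun n => Nat.casesOn n d a

lemma measurable_consDigit (d : Fin 3) : Measurable (consDigit d) := by
  refine measurable_pi_lambda _ fun n => ?_
  cases n with
  | zero => exact measurable_const
  | succ n => exact measurable_pi_apply n

/-- The law of a sequence of independent digits `0` and `2`. -/
noncomputable def digitSeqMeasure : Measure (ℕ → Fin 3) :=
  Measure.infinitePi fun _ : ℕ => digitMeasure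

instance : IsProbabilityMeasure digitSeqMeasure := by
  unfold digitSeqMeasure; infer_instance

lemma digitMeasure_apply (s : Set (Fin 3)) :
    digitMeasure s = 2⁻¹ * s.indicator 1 0 + 2⁻¹ * s.indicator 1 2 := by
  have hs : MeasurableSet s := MeasurableSet.of_discrete
  simp [digitMeasure, Measure.dirac_apply' _ hs]

lemma digitSeqMeasure_consDigit_preimage (d : Fin 3) (N : ℕ) (t : ℕ → Set (Fin 3)) :
    digitSeqMeasure (consDigit d ⁻¹' Set.pi (Finset.range (N + 1) : Set ℕ) t) =
      (t 0).indicator 1 d * ∏ i ∈ Finset.range N, digitMeasure (t (i + 1)) := by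
  by_cases hd : d ∈ t 0
  · have : consDigit d ⁻¹' Set.pi (Finset.range (N + 1) : Set ℕ) t =
        Set.pi (Finset.range N : Set ℕ) fun i => t (i + 1) := by
      ext a
      simp only [Set.mem_preimage, Set.mem_pi, Finset.coe_range, Set.mem_Iio]
      constructor
      · intro h i hi
        exact h (i + 1) (by omega)
      · intro h i hi
        cases i with
        | zero => exact hd
        | succ i => exact h i (by omega)
    rw [this, digitSeqMeasure, Measure.infinitePi_pi _ fun _ _ => MeasurableSet.of_discrete]
    simp [hd]
  · have : consDigit d ⁻¹' Set.pi (Finset.range (N + 1) : Set ℕ) t = ∅ := by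
      ext a
      simp only [Set.mem_preimage, Set.mem_pi, Set.mem_empty_iff_false, iff_false]
      intro h
      exact hd (h 0 (by simp))
    rw [this]
    simp [hd]

/-- A product measure is determined by finite boxes. Padding the box to an initial segment of
indices lets the first digit be split off from the shifted rest. -/
lemma digitSeqMeasure_eq :
    (2⁻¹ : ℝ≥0∞) • digitSeqMeasure.map (consDigit 0) +
      (2⁻¹ : ℝ≥0∞) • digitSeqMeasure.map (consDigit 2) = digitSeqMeasure := by
  refine Measure.eq_infinitePi _ fun s t _ => ?_
  classical
  obtain ⟨N, hN⟩ : ∃ N, s ⊆ Finset.range (N + 1) :=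
    ⟨s.sup id, fun i hi => Finset.mem_range.2 (Nat.lt_succ_of_le (Finset.le_sup (f := id) hi))⟩
  let t' : ℕ → Set (Fin 3) := fun i => if i ∈ s then t i else Set.univ
  have hpi : Set.pi (s : Set ℕ) t = Set.pi (Finset.range (N + 1) : Set ℕ) t' := by
    ext a
    simp only [Set.mem_pi, Finset.mem_coe, t']
    constructor
    · intro h i _
      split_ifs with his
      · exact h i his
      · trivial
    · intro h i hi
      simpa [hi] using h i (hN hi)
  have hprod : ∏ i ∈ s, digitMeasure (t i) =
      ∏ i ∈ Finset.range (N + 1), digitMeasure (t' i) := by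
    rw [← Finset.prod_subset hN]
    · exact Finset.prod_congr rfl fun i hi => by simp [t', hi]
    · intro i _ hi
      simp [t', hi]
  have hm : MeasurableSet (Set.pi (Finset.range (N + 1) : Set ℕ) t') :=
    MeasurableSet.pi (Finset.countable_toSet _) fun _ _ => MeasurableSet.of_discrete
  rw [hpi, hprod, Finset.prod_range_succ', Measure.add_apply, Measure.smul_apply,
    Measure.smul_apply, Measure.map_apply (measurable_consDigit _) hm,
    Measure.map_apply (measurable_consDigit _) hm, digitSeqMeasure_consDigit_preimage,
    digitSeqMeasure_consDigit_preimage, digitMeasure_apply (t' 0), smul_eq_mul, smul_eq_mul]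
  ring

lemma ofDigits_consDigit (d : Fin 3) (a : ℕ → Fin 3) :
    Real.ofDigits (consDigit d a) = (Real.ofDigits a + (d : ℕ)) / 3 := by
  rw [Real.ofDigits_eq_sum_add_ofDigits _ 1]
  have hs : (fun i => consDigit d a (i + 1)) = a := rfl
  have h0 : consDigit d a 0 = d := rfl
  simp only [Finset.sum_range_one, Real.ofDigitsTerm, hs, h0]
  push_cast
  ring

/-- The dyadic Cantor measure, as the law of a random ternary expansion. -/
noncomputable def cantorMeasure : Measure ℝ := digitSeqMeasure.map Real.ofDigits

lemma measurable_ofDigits : Measurable (@Real.ofDigits 3) :=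
  Real.continuous_ofDigits.measurable

lemma isDyadicCantorMeasure_cantorMeasure : IsDyadicCantorMeasure cantorMeasure := by
  refine ⟨Measure.isProbabilityMeasure_map measurable_ofDigits.aemeasurable, ?_⟩
  unfold cantorOperator
  conv_rhs => rw [cantorMeasure, ← digitSeqMeasure_eq]
  rw [Measure.map_add _ _ measurable_ofDigits, Measure.map_smul, Measure.map_smul,
    Measure.map_map measurable_ofDigits (measurable_consDigit _),
    Measure.map_map measurable_ofDigits (measurable_consDigit _), cantorMeasure,
    Measure.map_map (by fun_prop) measurable_ofDigits,
    Measure.map_map (by fun_prop) measurable_ofDigits]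
  congr 3 <;> funext a <;> simp [ofDigits_consDigit]

lemma cantorMeasure_compl_Icc : cantorMeasure (Set.Icc 0 1)ᶜ = 0 := by
  rw [cantorMeasure, Measure.map_apply measurable_ofDigits measurableSet_Icc.compl]
  convert measure_empty (μ := digitSeqMeasure)
  ext a
  simp [Real.ofDigits_nonneg, Real.ofDigits_le_one]

/-! ### Uniqueness by characteristic functions. -/

lemma charFun_cantorOperator (μ : Measure ℝ) [IsFiniteMeasure μ] (t : ℝ) :
    charFun (cantorOperator μ) t =
      (1 + Complex.exp ((2 * t / 3 : ℝ) * Complex.I)) / 2 * charFun μ (t / 3) := by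
  have h0 : charFun (μ.map fun x : ℝ => x / 3) t = charFun μ (t / 3) := by
    have := charFun_map_mul (μ := μ) 3⁻¹ t
    simpa [div_eq_inv_mul] using this
  have h2 : charFun (μ.map fun x : ℝ => (x + 2) / 3) t =
      charFun μ (t / 3) * Complex.exp ((2 * t / 3 : ℝ) * Complex.I) := by
    have h : μ.map (fun x : ℝ => (x + 2) / 3) =
        (μ.map fun x : ℝ => x / 3).map (· + (2 / 3 : ℝ)) := by
      rw [Measure.map_map (by fun_prop) (by fun_prop)]
      congr 1
      funext x
      simp only [Function.comp]
      ring
    rw [h, charFun_map_add_const, h0]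
    congr 3
    simp only [RCLike.inner_apply, conj_trivial]
    push_cast
    ring
  have i0 : ∀ ν : Measure ℝ, IsFiniteMeasure ν →
      Integrable (fun x : ℝ => Complex.exp (t * x * Complex.I)) ν := by
    intro ν _
    refine (integrable_const (1 : ℝ)).mono (by fun_prop) (ae_of_all _ fun x => ?_)
    rw [← Complex.ofReal_mul, Complex.norm_exp_ofReal_mul_I]
    simp
  have f0 : IsFiniteMeasure ((2⁻¹ : ℝ≥0∞) • μ.map (fun x : ℝ => x / 3)) :=
    Measure.smul_finite _ (by simp)
  have f2 : IsFiniteMeasure ((2⁻¹ : ℝ≥0∞) • μ.map (fun x : ℝ => (x + 2) / 3)) :=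
    Measure.smul_finite _ (by simp)
  rw [cantorOperator, charFun_apply_real, integral_add_measure (i0 _ f0) (i0 _ f2),
    integral_smul_measure, integral_smul_measure, ← charFun_apply_real, ← charFun_apply_real,
    h0, h2]
  simp
  ring

/-- The factor in `charFun_cantorOperator` has modulus at most 1, so the difference of two solutions
at `t` is bounded by that at `t / 3ⁿ`, which tends to 0 because both functions are continuous and
equal 1 at 0. -/
lemma IsDyadicCantorMeasure.unique {μ ν : Measure ℝ} (hμ : IsDyadicCantorMeasure μ)
    (hν : IsDyadicCantorMeasure ν) : μ = ν := by
  have := hμ.1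
  have := hν.1
  refine Measure.ext_of_charFun (funext fun t => ?_)
  have hstep : ∀ t : ℝ, ‖charFun μ t - charFun ν t‖ ≤
      ‖charFun μ (t / 3) - charFun ν (t / 3)‖ := by
    intro t
    nth_rw 1 [← hμ.2, ← hν.2]
    rw [charFun_cantorOperator, charFun_cantorOperator, ← mul_sub, norm_mul]
    refine mul_le_of_le_one_left (norm_nonneg _) ?_
    rw [norm_div]
    have := norm_add_le (1 : ℂ) (Complex.exp ((2 * t / 3 : ℝ) * Complex.I))
    rw [Complex.norm_exp_ofReal_mul_I] at this
    simp only [norm_one, Complex.norm_ofNat] at *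
    linarith
  have hiter : ∀ n : ℕ, ‖charFun μ t - charFun ν t‖ ≤
      ‖charFun μ (t * (1 / 3) ^ n) - charFun ν (t * (1 / 3) ^ n)‖ := by
    intro n
    induction n with
    | zero => simp
    | succ n ih =>
      refine ih.trans ((hstep _).trans_eq ?_)
      rw [pow_succ]
      congr 3 <;> ring
  have hlim : Tendsto (fun n : ℕ => ‖charFun μ (t * (1 / 3) ^ n) - charFun ν (t * (1 / 3) ^ n)‖)
      atTop (𝓝 0) := by
    have h0 : Tendsto (fun n : ℕ => t * (1 / 3 : ℝ) ^ n) atTop (𝓝 0) := by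
      simpa using (tendsto_pow_atTop_nhds_zero_of_lt_one (r := (1 / 3 : ℝ)) (by norm_num)
        (by norm_num)).const_mul t
    have hc : Continuous fun u : ℝ => ‖charFun μ u - charFun ν u‖ :=
      (continuous_charFun.sub continuous_charFun).norm
    have := (hc.tendsto 0).comp h0
    simpa [Function.comp_def] using this
  have := ge_of_tendsto' hlim hiter
  exact sub_eq_zero.1 (norm_le_zero_iff.1 this)

/-! ### Ahlfors regularity. -/

instance : IsProbabilityMeasure cantorMeasure := isDyadicCantorMeasure_cantorMeasure.1

lemma cantorMeasure_apply {s : Set ℝ} (hs : MeasurableSet s) :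
    cantorMeasure s = 2⁻¹ * cantorMeasure ((fun x : ℝ => x / 3) ⁻¹' s) +
      2⁻¹ * cantorMeasure ((fun x : ℝ => (x + 2) / 3) ⁻¹' s) := by
  conv_lhs => rw [← isDyadicCantorMeasure_cantorMeasure.2]
  rw [cantorOperator, Measure.add_apply, Measure.smul_apply, Measure.smul_apply,
    Measure.map_apply (by fun_prop) hs, Measure.map_apply (by fun_prop) hs, smul_eq_mul,
    smul_eq_mul]

lemma lintegral_cantorMeasure {f : ℝ → ℝ≥0∞} (hf : Measurable f) :
    ∫⁻ x, f x ∂cantorMeasure = 2⁻¹ * ∫⁻ x, f (x / 3) ∂cantorMeasure +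
      2⁻¹ * ∫⁻ x, f ((x + 2) / 3) ∂cantorMeasure := by
  conv_lhs => rw [← isDyadicCantorMeasure_cantorMeasure.2]
  rw [cantorOperator, lintegral_add_measure, lintegral_smul_measure, lintegral_smul_measure,
    lintegral_map hf (by fun_prop), lintegral_map hf (by fun_prop), smul_eq_mul, smul_eq_mul]

lemma ae_cantorMeasure_mem_Icc : ∀ᵐ x ∂cantorMeasure, x ∈ Set.Icc (0 : ℝ) 1 :=
  cantorMeasure_compl_Icc

lemma support_cantorMeasure_subset : cantorMeasure.support ⊆ Set.Icc 0 1 :=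
  Measure.support_subset_of_isClosed isClosed_Icc ae_cantorMeasure_mem_Icc

lemma cantorMeasure_eq_zero_of_disjoint {s : Set ℝ} (h : Disjoint s (Set.Icc 0 1)) :
    cantorMeasure s = 0 :=
  measure_mono_null h.subset_compl_right cantorMeasure_compl_Icc

lemma cantorMeasure_closedBall (x r : ℝ) :
    cantorMeasure (Metric.closedBall x r) =
      2⁻¹ * cantorMeasure (Metric.closedBall (3 * x) (3 * r)) +
        2⁻¹ * cantorMeasure (Metric.closedBall (3 * x - 2) (3 * r)) := by
  rw [cantorMeasure_apply Metric.isClosed_closedBall.measurableSet]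
  congr 3 <;>
  · ext y
    simp only [Set.mem_preimage, Metric.mem_closedBall, Real.dist_eq, abs_le]
    constructor <;> rintro ⟨h1, h2⟩ <;> constructor <;> linarith

/-- A ball of diameter less than `1 / 3` cannot meet both `[0, 1/3]` and `[2/3, 1]`, so each
rescaling keeps only one of the two terms and gains a factor `1 / 2`. -/
lemma cantorMeasure_closedBall_le_pow (k : ℕ) (x r : ℝ) (h : 2 * (r * 3 ^ k) < 1) :
    cantorMeasure (Metric.closedBall x r) ≤ 2⁻¹ ^ k := by
  induction k generalizing x r with
  | zero => simpa using prob_le_one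
  | succ k ih =>
    rw [cantorMeasure_closedBall]
    have h' : 2 * (3 * r * 3 ^ k) < 1 := by
      rw [pow_succ] at h
      linarith
    have hr : 6 * r < 1 := by
      by_contra hr
      have : (1 : ℝ) ≤ 3 ^ k := one_le_pow₀ (by norm_num)
      nlinarith
    have key : cantorMeasure (Metric.closedBall (3 * x) (3 * r)) = 0 ∨
        cantorMeasure (Metric.closedBall (3 * x - 2) (3 * r)) = 0 := by
      by_cases hx : 1 < 3 * x - 3 * r
      · left
        refine cantorMeasure_eq_zero_of_disjoint (Set.disjoint_left.2 fun y hy hy' => ?_)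
        rw [Metric.mem_closedBall, Real.dist_eq, abs_le] at hy
        linarith [hy'.2, hy.1]
      · right
        refine cantorMeasure_eq_zero_of_disjoint (Set.disjoint_left.2 fun y hy hy' => ?_)
        rw [Metric.mem_closedBall, Real.dist_eq, abs_le] at hy
        linarith [hy'.1, hy.2]
    rw [pow_succ']
    rcases key with h0 | h0
    · rw [h0, mul_zero, zero_add]
      gcongr
      exact ih _ _ h'
    · rw [h0, mul_zero, add_zero]
      gcongr
      exact ih _ _ h'

lemma mem_support_cantorMeasure_of_mem {x : ℝ} (hx : x ∈ cantorMeasure.support) :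
    3 * x ∈ cantorMeasure.support ∨ 3 * x - 2 ∈ cantorMeasure.support := by
  simp only [Metric.nhds_basis_closedBall.mem_measureSupport] at hx ⊢
  by_contra! h
  obtain ⟨⟨r, hr, h0⟩, ⟨r', hr', h2⟩⟩ := h
  have hm : 0 < min r r' / 3 := by positivity
  have := hx _ hm
  rw [cantorMeasure_closedBall] at this
  have h0' : cantorMeasure (Metric.closedBall (3 * x) (3 * (min r r' / 3))) = 0 :=
    measure_mono_null (Metric.closedBall_subset_closedBall (by linarith [min_le_left r r']))
      (nonpos_iff_eq_zero.1 h0)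
  have h2' : cantorMeasure (Metric.closedBall (3 * x - 2) (3 * (min r r' / 3))) = 0 :=
    measure_mono_null (Metric.closedBall_subset_closedBall (by linarith [min_le_right r r']))
      (nonpos_iff_eq_zero.1 h2)
  simp [h0', h2'] at this

lemma pow_le_cantorMeasure_closedBall (k : ℕ) (x r : ℝ) (hx : x ∈ cantorMeasure.support)
    (h : 1 ≤ r * 3 ^ k) : 2⁻¹ ^ k ≤ cantorMeasure (Metric.closedBall x r) := by
  induction k generalizing x r with
  | zero =>
    have hx' := support_cantorMeasure_subset hx
    have hsub : Set.Icc (0 : ℝ) 1 ⊆ Metric.closedBall x r := by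
      intro y hy
      rw [Metric.mem_closedBall, Real.dist_eq, abs_le]
      simp only [pow_zero, mul_one] at h
      constructor <;> linarith [hx'.1, hx'.2, hy.1, hy.2]
    have : cantorMeasure (Set.Icc 0 1) = 1 :=
      (prob_compl_eq_zero_iff measurableSet_Icc).1 cantorMeasure_compl_Icc
    rw [pow_zero, ← this]
    exact measure_mono hsub
  | succ k ih =>
    rw [cantorMeasure_closedBall, pow_succ']
    have h' : 1 ≤ 3 * r * 3 ^ k := by
      rw [pow_succ] at h
      linarith
    rcases mem_support_cantorMeasure_of_mem hx with h0 | h0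
    · refine le_trans ?_ le_self_add
      gcongr
      exact ih _ _ h0 h'
    · refine le_trans ?_ le_add_self
      gcongr
      exact ih _ _ h0 h'

lemma log_two_div_log_three_pos : 0 < Real.log 2 / Real.log 3 :=
  div_pos (Real.log_pos (by norm_num)) (Real.log_pos (by norm_num))

lemma three_rpow_log_two_div_log_three : (3 : ℝ) ^ (Real.log 2 / Real.log 3) = 2 := by
  rw [Real.rpow_def_of_pos (by norm_num), mul_div_cancel₀ _ (Real.log_pos (by norm_num)).ne',
    Real.exp_log (by norm_num)]

lemma inv_three_pow_rpow (k : ℕ) :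
    ((3 : ℝ)⁻¹ ^ k) ^ (Real.log 2 / Real.log 3) = 2⁻¹ ^ k := by
  rw [← Real.rpow_natCast, ← Real.rpow_mul (by norm_num), mul_comm, Real.rpow_mul (by norm_num),
    Real.inv_rpow (by norm_num), three_rpow_log_two_div_log_three, Real.rpow_natCast]

lemma exists_inv_three_pow_near {r : ℝ} (h0 : 0 < r) (h1 : r ≤ 1) :
    ∃ k : ℕ, 3⁻¹ ^ (k + 1) < r ∧ r ≤ 3⁻¹ ^ k :=
  exists_nat_pow_near_of_lt_one h0 h1 (by norm_num) (by norm_num)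

lemma cantorMeasure_real_closedBall_le (x : ℝ) {r : ℝ} (hr : 0 < r) :
    cantorMeasure.real (Metric.closedBall x r) ≤ (9 * r) ^ (Real.log 2 / Real.log 3) := by
  by_cases h1 : 9 * r ≤ 1
  · obtain ⟨k, hk, hk'⟩ := exists_inv_three_pow_near (by positivity) h1
    have hpow : (3 : ℝ)⁻¹ ^ k * 3 ^ k = 1 := by
      rw [← mul_pow]
      norm_num
    have h := cantorMeasure_closedBall_le_pow (k + 1) x r (by
      rw [pow_succ]
      nlinarith [mul_le_mul_of_nonneg_right hk' (by positivity : (0 : ℝ) ≤ 3 ^ k)])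
    have h' : cantorMeasure.real (Metric.closedBall x r) ≤ 2⁻¹ ^ (k + 1) := by
      refine ENNReal.toReal_le_of_le_ofReal (by positivity) (h.trans_eq ?_)
      rw [ENNReal.ofReal_pow (by norm_num), ENNReal.ofReal_inv_of_pos (by norm_num)]
      simp
    rw [← inv_three_pow_rpow] at h'
    exact h'.trans (Real.rpow_le_rpow (by positivity) hk.le log_two_div_log_three_pos.le)
  · exact measureReal_le_one.trans
      (Real.one_le_rpow (by linarith) log_two_div_log_three_pos.le)

/-- Here `r / 3` would do; `r / 9` lets the constant of the upper bound serve both sides. -/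
lemma le_cantorMeasure_real_closedBall {x r : ℝ} (hx : x ∈ cantorMeasure.support) (hr : 0 < r)
    (h1 : r ≤ 1) :
    (r / 9) ^ (Real.log 2 / Real.log 3) ≤ cantorMeasure.real (Metric.closedBall x r) := by
  obtain ⟨k, hk, hk'⟩ := exists_inv_three_pow_near hr h1
  have hpow : (3 : ℝ)⁻¹ ^ (k + 1) * 3 ^ (k + 1) = 1 := by
    rw [← mul_pow]
    norm_num
  have h := pow_le_cantorMeasure_closedBall (k + 1) x r hx (by
    rw [← hpow]
    gcongr)
  have h' : 2⁻¹ ^ (k + 1) ≤ cantorMeasure.real (Metric.closedBall x r) := by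
    refine (ENNReal.ofReal_le_iff_le_toReal (measure_ne_top _ _)).1 (le_trans (le_of_eq ?_) h)
    rw [ENNReal.ofReal_pow (by norm_num), ENNReal.ofReal_inv_of_pos (by norm_num)]
    simp
  refine le_trans ?_ h'
  rw [← inv_three_pow_rpow]
  refine Real.rpow_le_rpow (by positivity) ?_ log_two_div_log_three_pos.le
  rw [pow_succ]
  have : (0 : ℝ) < 3⁻¹ ^ k := by positivity
  linarith

/-- Regularity is also demanded at radius 0, where it says that there are no atoms. -/
lemma cantorMeasure_real_closedBall_zero (x : ℝ) :
    cantorMeasure.real (Metric.closedBall x 0) = 0 := by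
  have hs := log_two_div_log_three_pos
  have hlim : Tendsto (fun r : ℝ => (9 * r) ^ (Real.log 2 / Real.log 3)) (𝓝[>] 0) (𝓝 0) := by
    have hc : Continuous fun r : ℝ => (9 * r) ^ (Real.log 2 / Real.log 3) :=
      (continuous_const.mul continuous_id).rpow_const fun _ => Or.inr hs.le
    have := hc.tendsto 0
    rw [mul_zero, Real.zero_rpow hs.ne'] at this
    exact this.mono_left nhdsWithin_le_nhds
  refine le_antisymm (ge_of_tendsto hlim ?_) measureReal_nonneg
  filter_upwards [self_mem_nhdsWithin] with r hr
  exact (measureReal_mono (Metric.closedBall_subset_closedBall (le_of_lt hr))).trans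
    (cantorMeasure_real_closedBall_le x hr)

lemma isAhlforsRegular_cantorMeasure :
    IsAhlforsRegular (Real.log 2 / Real.log 3) cantorMeasure := by
  have hs := log_two_div_log_three_pos
  refine ⟨hs, inferInstance, isCompact_Icc.of_isClosed_subset Measure.isClosed_support
    support_cantorMeasure_subset, 9 ^ (Real.log 2 / Real.log 3), by positivity, ?_⟩
  intro x hx r hr0 hr
  have hr1 : r ≤ 1 := by
    refine hr.trans ((Metric.diam_mono support_cantorMeasure_subset
      (Metric.isBounded_Icc 0 1)).trans ?_)
    rw [Real.diam_Icc zero_le_one]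
    norm_num
  rcases hr0.eq_or_lt with rfl | hr0
  · rw [cantorMeasure_real_closedBall_zero, Real.zero_rpow hs.ne']
    simp
  · constructor
    · have := le_cantorMeasure_real_closedBall hx hr0 hr1
      rwa [Real.div_rpow hr0.le (by norm_num), div_eq_inv_mul] at this
    · have := cantorMeasure_real_closedBall_le x hr0
      rwa [Real.mul_rpow (by norm_num) hr0.le] at this

/-! ### Quantization as a nearest-point problem. -/

section Quantization

variable {X : Type*} [MetricSpace X] [MeasurableSpace X] [OpensMeasurableSpace X]

/-- The `p`-th power of the optimal cost of approximating `μ` by a measure on at most `N` points. -/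
noncomputable def quantErr (p : ℝ) (μ : Measure X) (N : ℕ) : ℝ≥0∞ :=
  ⨅ (t : Finset X) (_ : t.card ≤ N), ∫⁻ x, Metric.infEDist x (t : Set X) ^ p ∂μ

lemma lintegral_infEDist_le_transportCost {p : ℝ} (hp : 0 ≤ p) {μ ν : Measure X}
    {P : Measure (X × X)} (hP : IsTransportPlan μ ν P) {t : Finset X}
    (ht : ν (t : Set X)ᶜ = 0) :
    ∫⁻ x, Metric.infEDist x (t : Set X) ^ p ∂μ ≤ transportCost p P := by
  have hm : Measurable fun x : X => Metric.infEDist x (t : Set X) ^ p :=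
    measurable_infEDist.pow_const _
  rw [← hP.1, lintegral_map hm measurable_fst]
  refine lintegral_mono_ae ?_
  have h2 : ∀ᵐ z ∂P, z.2 ∈ (t : Set X) := by
    have : ∀ᵐ y ∂(P.map Prod.snd), y ∈ (t : Set X) := by
      rw [hP.2]
      exact ht
    exact ae_of_ae_map measurable_snd.aemeasurable this
  filter_upwards [h2] with z hz
  exact ENNReal.rpow_le_rpow (Metric.infEDist_le_edist_of_mem hz) hp

lemma exists_nearest_map {t : Finset X} (ht : t.Nonempty) :
    ∃ f : X → X, Measurable f ∧ (∀ x, f x ∈ t) ∧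
      ∀ x, edist x (f x) ≤ Metric.infEDist x (t : Set X) := by
  obtain ⟨y₀, hy₀⟩ := ht
  let l := t.toList
  -- Padding by `y₀ ∈ t` keeps every value of the sequence in `t`.
  let e : ℕ → X := fun n => l.getD n y₀
  have he : ∀ n, e n ∈ t := by
    intro n
    by_cases hn : n < l.length
    · simp only [e, List.getD_eq_getElem _ _ hn]
      exact Finset.mem_toList.1 (List.getElem_mem hn)
    · simp only [e, List.getD_eq_default _ _ (not_lt.1 hn)]
      exact hy₀
  have hes : ∀ y ∈ t, ∃ n ≤ l.length, e n = y := by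
    intro y hy
    obtain ⟨n, hn, rfl⟩ := List.getElem_of_mem (Finset.mem_toList.2 hy)
    exact ⟨n, hn.le, List.getD_eq_getElem _ _ hn⟩
  refine ⟨SimpleFunc.nearestPt e l.length, SimpleFunc.measurable _, fun x => ?_, fun x => ?_⟩
  · exact he _
  · refine Metric.le_infEDist.2 fun y hy => ?_
    obtain ⟨n, hn, rfl⟩ := hes y hy
    rw [edist_comm, edist_comm x]
    exact SimpleFunc.edist_nearestPt_le e x hn

/-- The masses of the approximating measure are free, so it is optimal to send each point to a
nearest atom. -/
lemma quantizationDist_rpow [SecondCountableTopology X] [BorelSpace X] {p : ℝ} (hp : 0 < p)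
    (μ : Measure X) [IsProbabilityMeasure μ] (N : ℕ) :
    quantizationDist p μ N ^ p = quantErr p μ N := by
  refine le_antisymm ?_ ?_
  · refine le_iInf₂ fun t ht => ?_
    rcases t.eq_empty_or_nonempty with rfl | hne
    · simp [ENNReal.top_rpow_of_pos hp]
    obtain ⟨f, hf, hft, hfe⟩ := exists_nearest_map hne
    have hpair : Measurable fun x : X => (x, f x) := measurable_id.prodMk hf
    have hν : μ.map f ∈ finSupported X N := by
      refine ⟨Measure.isFiniteMeasure_map _ _, t, ht, ?_⟩
      rw [Measure.map_apply hf t.measurableSet.compl]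
      convert measure_empty (μ := μ)
      ext x
      simp [hft]
    have hplan : IsTransportPlan μ (μ.map f) (μ.map fun x => (x, f x)) := by
      constructor
      · rw [Measure.map_map measurable_fst hpair]
        exact Measure.map_id
      · rw [Measure.map_map measurable_snd hpair]
        rfl
    have hcost : transportCost p (μ.map fun x => (x, f x)) ≤
        ∫⁻ x, Metric.infEDist x (t : Set X) ^ p ∂μ := by
      rw [transportCost, lintegral_map (by fun_prop) hpair]
      exact lintegral_mono fun x => ENNReal.rpow_le_rpow (hfe x) hp.le
    have h1 : quantizationDist p μ N ≤ transportCost p (μ.map fun x => (x, f x)) ^ (1 / p) :=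
      (iInf₂_le _ hν).trans (iInf₂_le _ hplan)
    rw [one_div, ENNReal.le_rpow_inv_iff hp] at h1
    exact h1.trans hcost
  · rw [← ENNReal.rpow_inv_le_iff hp]
    refine le_iInf₂ fun ν hν => le_iInf₂ fun P hP => ?_
    obtain ⟨-, t, ht, ht0⟩ := hν
    rw [one_div]
    gcongr
    exact (iInf₂_le t ht).trans (lintegral_infEDist_le_transportCost hp.le hP ht0)

end Quantization

/-! ### Self-similarity of the plain and guarded errors. -/

lemma quantErr_anti {X : Type*} [MetricSpace X] [MeasurableSpace X] (p : ℝ) (μ : Measure X) :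
    Antitone (quantErr p μ) := fun _ _ h =>
  le_iInf₂ fun t ht => iInf₂_le t (ht.trans h)

lemma inv_three_mul_edist_le {x y a b : ℝ} (h : |x - y| ≤ 3 * |a - b|) :
    3⁻¹ * edist x y ≤ edist a b := by
  rw [edist_dist, edist_dist, Real.dist_eq, Real.dist_eq,
    show (3⁻¹ : ℝ≥0∞) = ENNReal.ofReal 3⁻¹ by
      rw [ENNReal.ofReal_inv_of_pos (by norm_num)]; simp,
    ← ENNReal.ofReal_mul (by norm_num)]
  exact ENNReal.ofReal_le_ofReal (by linarith)

lemma edist_le_inv_three_mul {x y a b : ℝ} (h : 3 * |a - b| ≤ |x - y|) :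
    edist a b ≤ 3⁻¹ * edist x y := by
  rw [edist_dist, edist_dist, Real.dist_eq, Real.dist_eq,
    show (3⁻¹ : ℝ≥0∞) = ENNReal.ofReal 3⁻¹ by
      rw [ENNReal.ofReal_inv_of_pos (by norm_num)]; simp,
    ← ENNReal.ofReal_mul (by norm_num)]
  exact ENNReal.ofReal_le_ofReal (by linarith)

lemma inv_three_mul_infEDist_le {x a : ℝ} {t u : Set ℝ}
    (h : ∀ b ∈ u, ∃ y ∈ t, |x - y| ≤ 3 * |a - b|) :
    3⁻¹ * Metric.infEDist x t ≤ Metric.infEDist a u := by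
  refine Metric.le_infEDist.2 fun b hb => ?_
  obtain ⟨y, hy, hxy⟩ := h b hb
  exact (mul_le_mul_right (Metric.infEDist_le_edist_of_mem hy) _).trans
    (inv_three_mul_edist_le hxy)

lemma infEDist_le_inv_three_mul {x a : ℝ} {t u : Set ℝ}
    (h : ∀ y ∈ t, ∃ b ∈ u, 3 * |a - b| ≤ |x - y|) :
    Metric.infEDist a u ≤ 3⁻¹ * Metric.infEDist x t := by
  rw [← ENNReal.div_eq_inv_mul, ENNReal.le_div_iff_mul_le (by simp) (by simp), mul_comm]
  refine Metric.le_infEDist.2 fun y hy => ?_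
  obtain ⟨b, hb, hab⟩ := h y hy
  have h1 := (Metric.infEDist_le_edist_of_mem hb).trans (edist_le_inv_three_mul hab)
  rwa [← ENNReal.div_eq_inv_mul, ENNReal.le_div_iff_mul_le (by simp) (by simp), mul_comm] at h1

/-- The mean `p`-th power of the distance to `t` under the Cantor measure. -/
noncomputable def cantorCost (p : ℝ) (t : Set ℝ) : ℝ≥0∞ :=
  ∫⁻ x, Metric.infEDist x t ^ p ∂cantorMeasure

lemma measurable_infEDist_rpow (p : ℝ) (t : Set ℝ) :
    Measurable fun x : ℝ => Metric.infEDist x t ^ p :=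
  measurable_infEDist.pow_const _

lemma cantorCost_eq (p : ℝ) (t : Set ℝ) :
    cantorCost p t = 2⁻¹ * ∫⁻ x, Metric.infEDist (x / 3) t ^ p ∂cantorMeasure +
      2⁻¹ * ∫⁻ x, Metric.infEDist ((x + 2) / 3) t ^ p ∂cantorMeasure :=
  lintegral_cantorMeasure (measurable_infEDist_rpow p t)

lemma rpow_mul_cantorCost {p : ℝ} (hp : 0 ≤ p) (t : Set ℝ) :
    3⁻¹ ^ p * cantorCost p t =
      ∫⁻ x, (3⁻¹ * Metric.infEDist x t) ^ p ∂cantorMeasure := by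
  simp_rw [ENNReal.mul_rpow_of_nonneg _ _ hp]
  rw [lintegral_const_mul _ (measurable_infEDist_rpow p t), cantorCost]

lemma inv_two_mul_add_self (a : ℝ≥0∞) : 2⁻¹ * a + 2⁻¹ * a = a := by
  rw [← add_mul, ENNReal.inv_two_add_inv_two, one_mul]

lemma quantErr_two_mul_le {p : ℝ} (hp : 0 ≤ p) (N : ℕ) :
    quantErr p cantorMeasure (2 * N) ≤ 3⁻¹ ^ p * quantErr p cantorMeasure N := by
  have hc0 : (3⁻¹ : ℝ≥0∞) ^ p ≠ 0 := by simp [ENNReal.rpow_eq_zero_iff]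
  have hct : (3⁻¹ : ℝ≥0∞) ^ p ≠ ∞ := ENNReal.rpow_ne_top_of_nonneg hp (by simp)
  unfold quantErr
  rw [ENNReal.mul_iInf_of_ne hc0 hct]
  refine le_iInf fun t => ?_
  rw [ENNReal.mul_iInf_of_ne hc0 hct]
  refine le_iInf fun ht => ?_
  let u : Finset ℝ := t.image (fun x => x / 3) ∪ t.image (fun x => (x + 2) / 3)
  have hu : u.card ≤ 2 * N := by
    refine (Finset.card_union_le _ _).trans ?_
    have h1 := Finset.card_image_le (s := t) (f := fun x : ℝ => x / 3)
    have h2 := Finset.card_image_le (s := t) (f := fun x : ℝ => (x + 2) / 3)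
    omega
  refine (iInf₂_le u hu).trans ?_
  change cantorCost p u ≤ 3⁻¹ ^ p * cantorCost p t
  rw [cantorCost_eq, rpow_mul_cantorCost hp]
  refine le_trans ?_ (inv_two_mul_add_self _).le
  gcongr with x x
  · refine infEDist_le_inv_three_mul fun y hy => ⟨y / 3, ?_, ?_⟩
    · exact Finset.mem_coe.2 (Finset.mem_union_left _ (Finset.mem_image_of_mem _ hy))
    · rw [← sub_div, abs_div, abs_of_pos (by norm_num : (0 : ℝ) < 3)]
      linarith
  · refine infEDist_le_inv_three_mul fun y hy => ⟨(y + 2) / 3, ?_, ?_⟩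
    · exact Finset.mem_coe.2 (Finset.mem_union_right _
        (Finset.mem_image_of_mem (fun x : ℝ => (x + 2) / 3) hy))
    · rw [← sub_div, abs_div, abs_of_pos (by norm_num : (0 : ℝ) < 3), add_sub_add_right_eq_sub]
      linarith

/-- Two points on either side of `[0, 1]`, at distance `1 / 2`. -/
noncomputable def guardPoints : Finset ℝ := {-1 / 2, 3 / 2}

/-- The optimal cost of approximating the Cantor measure by `N` points with the help of the two
guard points. -/
noncomputable def guardedErr (p : ℝ) (N : ℕ) : ℝ≥0∞ :=
  ⨅ (t : Finset ℝ) (_ : t.card ≤ N), cantorCost p (t ∪ guardPoints : Finset ℝ)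

lemma cantorCost_anti {p : ℝ} (hp : 0 ≤ p) {t u : Set ℝ} (h : t ⊆ u) :
    cantorCost p u ≤ cantorCost p t :=
  lintegral_mono fun _ => ENNReal.rpow_le_rpow (Metric.infEDist_anti h) hp

lemma guardedErr_le_quantErr {p : ℝ} (hp : 0 ≤ p) (N : ℕ) :
    guardedErr p N ≤ quantErr p cantorMeasure N :=
  iInf₂_mono fun _ _ => cantorCost_anti hp (Finset.coe_subset.2 Finset.subset_union_left)

/-- The inner guards of both halves, `S⁰ (3/2)` and `S¹ (-1/2)`, lie at the cut `1/2`. For either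
half, the guard at the cut is at least as close as any point across it, and the outer guard is
closer than the original guard on that side. So each half needs only its own points, rescaled. -/
lemma guardedErr_split {p : ℝ} (hp : 0 ≤ p) (t : Finset ℝ) :
    ∃ a b : ℕ, a + b ≤ t.card ∧
      2⁻¹ * (3⁻¹ ^ p * guardedErr p a) + 2⁻¹ * (3⁻¹ ^ p * guardedErr p b) ≤
        cantorCost p (t ∪ guardPoints : Finset ℝ) := by
  let l : Finset ℝ := (t.filter fun y => y < 1 / 2).image fun y => 3 * y
  let r : Finset ℝ := (t.filter fun y => ¬ y < 1 / 2).image fun y => 3 * y - 2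
  refine ⟨l.card, r.card, ?_, ?_⟩
  · rw [← Finset.card_filter_add_card_filter_not (s := t) (fun y : ℝ => y < 1 / 2)]
    exact add_le_add Finset.card_image_le Finset.card_image_le
  have hl : guardedErr p l.card ≤ cantorCost p (l ∪ guardPoints : Finset ℝ) :=
    iInf₂_le (f := fun (t : Finset ℝ) (_ : t.card ≤ l.card) =>
      cantorCost p (t ∪ guardPoints : Finset ℝ)) l le_rfl
  have hr : guardedErr p r.card ≤ cantorCost p (r ∪ guardPoints : Finset ℝ) :=
    iInf₂_le (f := fun (t : Finset ℝ) (_ : t.card ≤ r.card) =>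
      cantorCost p (t ∪ guardPoints : Finset ℝ)) r le_rfl
  rw [cantorCost_eq]
  refine add_le_add ?_ ?_
  · gcongr
    refine (mul_le_mul_right hl _).trans ?_
    rw [rpow_mul_cantorCost hp]
    refine lintegral_mono_ae ?_
    filter_upwards [ae_cantorMeasure_mem_Icc] with x hx
    refine ENNReal.rpow_le_rpow (inv_three_mul_infEDist_le fun y hy => ?_) hp
    simp only [guardPoints, Finset.coe_union, Finset.coe_insert, Finset.coe_singleton,
      Set.mem_union, Finset.mem_coe, Set.mem_insert_iff, Set.mem_singleton_iff] at hy ⊢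
    by_cases hy2 : y < 1 / 2
    · rcases hy with hy | rfl | rfl
      · refine ⟨3 * y, Or.inl (Finset.mem_image_of_mem (fun y : ℝ => 3 * y)
          (Finset.mem_filter.2 ⟨hy, hy2⟩)), le_of_eq ?_⟩
        rw [← abs_of_pos (by norm_num : (0 : ℝ) < 3), ← abs_mul,
          abs_of_pos (by norm_num : (0 : ℝ) < 3)]
        congr 1
        ring
      · refine ⟨-1 / 2, Or.inr (Or.inl rfl), ?_⟩
        rw [abs_of_nonneg (by linarith [hx.1]), abs_of_nonneg (by linarith [hx.1])]
        linarith
      · norm_num at hy2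
    · refine ⟨3 / 2, Or.inr (Or.inr rfl), ?_⟩
      rw [abs_of_nonpos (by linarith [hx.2]), abs_of_nonpos (by linarith [hx.2])]
      linarith
  · gcongr
    refine (mul_le_mul_right hr _).trans ?_
    rw [rpow_mul_cantorCost hp]
    refine lintegral_mono_ae ?_
    filter_upwards [ae_cantorMeasure_mem_Icc] with x hx
    refine ENNReal.rpow_le_rpow (inv_three_mul_infEDist_le fun y hy => ?_) hp
    simp only [guardPoints, Finset.coe_union, Finset.coe_insert, Finset.coe_singleton,
      Set.mem_union, Finset.mem_coe, Set.mem_insert_iff, Set.mem_singleton_iff] at hy ⊢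
    by_cases hy2 : y < 1 / 2
    · refine ⟨-1 / 2, Or.inr (Or.inl rfl), ?_⟩
      rw [abs_of_nonneg (by linarith [hx.1]), abs_of_nonneg (by linarith [hx.1])]
      linarith
    · rcases hy with hy | rfl | rfl
      · refine ⟨3 * y - 2, Or.inl (Finset.mem_image_of_mem (fun y : ℝ => 3 * y - 2)
          (Finset.mem_filter.2 ⟨hy, hy2⟩)), le_of_eq ?_⟩
        rw [← abs_of_pos (by norm_num : (0 : ℝ) < 3), ← abs_mul,
          abs_of_pos (by norm_num : (0 : ℝ) < 3)]
        congr 1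
        ring
      · norm_num at hy2
      · refine ⟨3 / 2, Or.inr (Or.inr rfl), ?_⟩
        rw [abs_of_nonpos (by linarith [hx.2]), abs_of_nonpos (by linarith [hx.2])]
        linarith

lemma ofReal_inv_three_rpow (p : ℝ) :
    ENNReal.ofReal ((3⁻¹ : ℝ) ^ p) = 3⁻¹ ^ p := by
  rw [← ENNReal.ofReal_rpow_of_pos (by norm_num), ENNReal.ofReal_inv_of_pos (by norm_num)]
  simp

/-- An affine lower bound for the guarded errors is inherited by the rescaled errors. -/
lemma affine_le_guardedErr_half {p α β : ℝ} (hp : 0 ≤ p) (hβ : 0 ≤ β)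
    (h : ∀ m : ℕ, ENNReal.ofReal (α - β * m) ≤ guardedErr p m) (m : ℕ) :
    ENNReal.ofReal (3⁻¹ ^ p * (α - β / 2 * m)) ≤ guardedErr p m := by
  refine le_iInf₂ fun t ht => ?_
  obtain ⟨a, b, hab, hle⟩ := guardedErr_split hp t
  refine le_trans ?_ hle
  have hc : (0 : ℝ) ≤ 3⁻¹ ^ p := by positivity
  have hm : (a : ℝ) + b ≤ m := by exact_mod_cast hab.trans ht
  have h2 : ENNReal.ofReal 2⁻¹ = 2⁻¹ := by
    rw [ENNReal.ofReal_inv_of_pos (by norm_num)]; simp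
  calc ENNReal.ofReal (3⁻¹ ^ p * (α - β / 2 * m))
      ≤ ENNReal.ofReal (2⁻¹ * (3⁻¹ ^ p * (α - β * a)) + 2⁻¹ * (3⁻¹ ^ p * (α - β * b))) := by
        refine ENNReal.ofReal_le_ofReal ?_
        have : (3⁻¹ : ℝ) ^ p * (β * (a + b)) ≤ 3⁻¹ ^ p * (β * m) := by gcongr
        nlinarith
    _ ≤ _ := ENNReal.ofReal_add_le
    _ ≤ _ := by
        rw [ENNReal.ofReal_mul (by norm_num), ENNReal.ofReal_mul hc,
          ENNReal.ofReal_mul (by norm_num), ENNReal.ofReal_mul hc, h2, ofReal_inv_three_rpow]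
        gcongr
        · exact h a
        · exact h b

lemma affine_le_guardedErr_div_pow {p α β : ℝ} (hp : 0 ≤ p) (hβ : 0 ≤ β)
    (h : ∀ m : ℕ, ENNReal.ofReal (α - β * m) ≤ guardedErr p m) (k m : ℕ) :
    ENNReal.ofReal ((3⁻¹ ^ p) ^ k * (α - β / 2 ^ k * m)) ≤ guardedErr p m := by
  induction k generalizing m with
  | zero => simpa using h m
  | succ k ih =>
    have hs := affine_le_guardedErr_half hp (α := (3⁻¹ ^ p) ^ k * α)
      (β := (3⁻¹ ^ p) ^ k * (β / 2 ^ k)) (by positivity)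
      (fun m => by simpa only [mul_sub, mul_assoc] using ih m) m
    convert hs using 2
    rw [pow_succ, pow_succ]
    field_simp

/-- Small enough balls around `N + 2` points cover at most half of the mass. -/
lemma guardedErr_pos {p : ℝ} (hp : 0 < p) (N : ℕ) : 0 < guardedErr p N := by
  -- Each ball then has mass at most `2⁻¹ ^ (N + 3)`, and there are at most `N + 2 ≤ 2 ^ (N + 2)` of
  -- them.
  let r : ℝ := (4 * 3 ^ (N + 3))⁻¹
  have hr : 0 < r := by positivity
  have hpos : 0 < ENNReal.ofReal r ^ p * 2⁻¹ :=
    ENNReal.mul_pos (ENNReal.rpow_pos (ENNReal.ofReal_pos.2 hr) ENNReal.ofReal_ne_top).ne'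
      (by simp)
  refine hpos.trans_le (le_iInf₂ fun t ht => ?_)
  set u := t ∪ guardPoints
  have hu : u.card ≤ N + 2 := by
    refine (Finset.card_union_le _ _).trans (add_le_add ht ?_)
    exact Finset.card_le_two
  let B : Set ℝ := ⋃ y ∈ u, Metric.closedBall y r
  have hBm : MeasurableSet B :=
    Finset.measurableSet_biUnion _ fun _ _ => Metric.isClosed_closedBall.measurableSet
  have hB : cantorMeasure B ≤ 2⁻¹ := by
    calc cantorMeasure B ≤ ∑ y ∈ u, cantorMeasure (Metric.closedBall y r) :=
          measure_biUnion_finset_le _ _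
      _ ≤ ∑ _y ∈ u, 2⁻¹ ^ (N + 3) := by
          refine Finset.sum_le_sum fun y _ => cantorMeasure_closedBall_le_pow _ _ _ ?_
          simp only [r]
          rw [mul_inv, mul_assoc, inv_mul_cancel₀ (by positivity)]
          norm_num
      _ ≤ 2 ^ (N + 2) * 2⁻¹ ^ (N + 3) := by
          rw [Finset.sum_const, nsmul_eq_mul]
          gcongr
          exact_mod_cast hu.trans (Nat.lt_two_pow_self).le
      _ = 2⁻¹ := by
          rw [pow_succ 2⁻¹, ← mul_assoc, ← mul_pow, ENNReal.mul_inv_cancel (by simp) (by simp),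
            one_pow, one_mul]
  have hBc : 2⁻¹ ≤ cantorMeasure Bᶜ := by
    rw [prob_compl_eq_one_sub hBm]
    refine le_trans ?_ (tsub_le_tsub_left hB 1)
    rw [ENNReal.one_sub_inv_two]
  have hsub : Bᶜ ⊆ {x | ENNReal.ofReal r ^ p ≤ Metric.infEDist x (u : Set ℝ) ^ p} := by
    intro x hx
    refine ENNReal.rpow_le_rpow (Metric.le_infEDist.2 fun y hy => ?_) hp.le
    have : r < dist x y := by
      by_contra! h
      exact hx (Set.mem_biUnion hy (Metric.mem_closedBall.2 h))
    rw [edist_dist]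
    exact ENNReal.ofReal_le_ofReal this.le
  calc ENNReal.ofReal r ^ p * 2⁻¹
      ≤ ENNReal.ofReal r ^ p *
        cantorMeasure {x | ENNReal.ofReal r ^ p ≤ Metric.infEDist x (u : Set ℝ) ^ p} := by
        gcongr
        exact hBc.trans (measure_mono hsub)
    _ ≤ _ := mul_meas_ge_le_lintegral (measurable_infEDist_rpow p _) _

lemma half_le_infEDist_guardPoints {x : ℝ} (hx : x ∈ Set.Icc (0 : ℝ) 1) :
    ENNReal.ofReal (1 / 2) ≤ Metric.infEDist x (guardPoints : Set ℝ) := by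
  refine Metric.le_infEDist.2 fun y hy => ?_
  rw [edist_dist, Real.dist_eq]
  refine ENNReal.ofReal_le_ofReal ?_
  simp only [guardPoints, Finset.coe_insert, Finset.coe_singleton, Set.mem_insert_iff,
    Set.mem_singleton_iff] at hy
  rcases hy with rfl | rfl
  · exact (by linarith [hx.1] : (1 / 2 : ℝ) ≤ x - -1 / 2).trans (le_abs_self _)
  · exact (by linarith [hx.2] : (1 / 2 : ℝ) ≤ -(x - 3 / 2)).trans (neg_le_abs _)

/-- The guard points only help when the other points leave a hole of macroscopic size. -/
lemma cantorCost_le_or_le {p : ℝ} (hp : 0 ≤ p) (t : Finset ℝ) :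
    cantorCost p t ≤ cantorCost p (t ∪ guardPoints : Finset ℝ) ∨
      ENNReal.ofReal (1 / 4) ^ p * 2⁻¹ ^ 2 ≤ cantorCost p (t ∪ guardPoints : Finset ℝ) := by
  by_cases h : ∀ x ∈ cantorMeasure.support,
      Metric.infEDist x (t : Set ℝ) ≤ ENNReal.ofReal (1 / 2)
  · left
    refine lintegral_mono_ae ?_
    filter_upwards [cantorMeasure.support_mem_ae] with x hx
    refine ENNReal.rpow_le_rpow ?_ hp
    rw [Finset.coe_union, Metric.infEDist_union]
    exact le_inf le_rfl
      ((h x hx).trans (half_le_infEDist_guardPoints (support_cantorMeasure_subset hx)))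
  · right
    push Not at h
    obtain ⟨x, hx, hxt⟩ := h
    -- The point `x` is farther than `1/2` from `t`, so its ball of radius `1/4`, of mass at least
    -- `2⁻¹ ^ 2`, stays at distance at least `1/4` from `t`.
    have hball := pow_le_cantorMeasure_closedBall 2 x (1 / 4) hx (by norm_num)
    have hae : ∀ᵐ y ∂cantorMeasure, y ∈ Metric.closedBall x (1 / 4) →
        ENNReal.ofReal (1 / 4) ^ p ≤
          Metric.infEDist y (t ∪ guardPoints : Finset ℝ) ^ p := by
      filter_upwards [ae_cantorMeasure_mem_Icc] with y hy hyx
      refine ENNReal.rpow_le_rpow ?_ hp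
      rw [Finset.coe_union, Metric.infEDist_union]
      refine le_inf ?_ ((ENNReal.ofReal_le_ofReal (by norm_num)).trans
        (half_le_infEDist_guardPoints hy))
      refine Metric.le_infEDist.2 fun z hz => ?_
      have h1 := hxt.trans_le (Metric.infEDist_le_edist_of_mem hz)
      rw [edist_dist, ENNReal.ofReal_lt_ofReal_iff'] at h1
      rw [edist_dist]
      refine ENNReal.ofReal_le_ofReal ?_
      have h2 := dist_triangle x y z
      rw [Metric.mem_closedBall, dist_comm] at hyx
      linarith [h1.1]
    calc ENNReal.ofReal (1 / 4) ^ p * 2⁻¹ ^ 2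
        ≤ ENNReal.ofReal (1 / 4) ^ p * cantorMeasure
          {y | ENNReal.ofReal (1 / 4) ^ p ≤
            Metric.infEDist y (t ∪ guardPoints : Finset ℝ) ^ p} := by
          gcongr
          exact hball.trans (measure_mono_ae hae)
      _ ≤ _ := mul_meas_ge_le_lintegral (measurable_infEDist_rpow p _) _

lemma quantErr_le_guardedErr_of_lt {p : ℝ} (hp : 0 ≤ p) {N : ℕ}
    (h : quantErr p cantorMeasure N < ENNReal.ofReal (1 / 4) ^ p * 2⁻¹ ^ 2) :
    quantErr p cantorMeasure N ≤ guardedErr p N := by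
  refine le_iInf₂ fun t ht => ?_
  rcases cantorCost_le_or_le hp t with h1 | h1
  · exact (iInf₂_le t ht).trans h1
  · exact h.le.trans h1

lemma quantErr_one_le {p : ℝ} (hp : 0 ≤ p) : quantErr p cantorMeasure 1 ≤ 1 := by
  refine (iInf₂_le {0} (by simp)).trans ?_
  calc ∫⁻ x, Metric.infEDist x (({0} : Finset ℝ) : Set ℝ) ^ p ∂cantorMeasure
      ≤ ∫⁻ _, 1 ∂cantorMeasure := by
        refine lintegral_mono_ae ?_
        filter_upwards [ae_cantorMeasure_mem_Icc] with x hx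
        refine ENNReal.rpow_le_one ?_ hp
        rw [Finset.coe_singleton, Metric.infEDist_singleton, edist_dist, Real.dist_eq, sub_zero,
          abs_of_nonneg hx.1]
        exact ENNReal.ofReal_le_one.2 hx.2
    _ = 1 := by simp

lemma quantErr_two_pow_mul_le {p : ℝ} (hp : 0 ≤ p) (k N : ℕ) :
    quantErr p cantorMeasure (2 ^ k * N) ≤ (3⁻¹ ^ p) ^ k * quantErr p cantorMeasure N := by
  induction k with
  | zero => simp
  | succ k ih =>
    rw [pow_succ', mul_assoc, pow_succ', mul_assoc]
    exact (quantErr_two_mul_le hp _).trans (mul_le_mul_right ih _)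

lemma tendsto_quantErr {p : ℝ} (hp : 0 < p) :
    Tendsto (quantErr p cantorMeasure) atTop (𝓝 0) := by
  have hanti := quantErr_anti p cantorMeasure
  have h1 : Tendsto (fun k : ℕ => ((3⁻¹ : ℝ≥0∞) ^ p) ^ k) atTop (𝓝 0) :=
    ENNReal.tendsto_pow_atTop_nhds_zero_of_lt_one (ENNReal.rpow_lt_one (by simp) hp)
  rw [ENNReal.tendsto_atTop_zero] at h1 ⊢
  intro ε hε
  obtain ⟨k, hk⟩ := h1 ε hε
  refine ⟨2 ^ k * 1, fun n hn => (hanti hn).trans ?_⟩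
  calc quantErr p cantorMeasure (2 ^ k * 1) ≤ (3⁻¹ ^ p) ^ k * quantErr p cantorMeasure 1 :=
        quantErr_two_pow_mul_le hp.le k 1
    _ ≤ (3⁻¹ ^ p) ^ k * 1 := by
        gcongr
        exact quantErr_one_le hp.le
    _ ≤ ε := by
        rw [mul_one]
        exact hk k le_rfl

/-! ### Supporting lines and strict convexity. -/

lemma exists_forall_le_of_eventually_le {f : ℕ → ℝ} (x : ℕ) (h : ∀ᶠ y in atTop, f y ≤ f x) :
    ∃ n, ∀ m, f m ≤ f n :=
  continuous_of_discreteTopology.exists_forall_ge' x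
    (by rwa [cocompact_eq_cofinite, Nat.cofinite_eq_atTop])

/-- A positive sequence tending to zero lies above the line through two of its points, which may
be taken arbitrarily far out. -/
lemma exists_supporting_line {g : ℕ → ℝ} (hpos : ∀ n, 0 < g n) (hlim : Tendsto g atTop (𝓝 0))
    (N : ℕ) : ∃ (n n' : ℕ) (σ : ℝ), N ≤ n ∧ n < n' ∧ 0 ≤ σ ∧
      (∀ m : ℕ, g n - σ * (m - n) ≤ g m) ∧ g n' = g n - σ * (n' - n) := by
  obtain ⟨c, hc, hcg⟩ : ∃ c : ℝ, 0 < c ∧ ∀ m < N, c ≤ g m := by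
    induction N with
    | zero => exact ⟨1, one_pos, by simp⟩
    | succ N ih =>
      obtain ⟨c, hc, h⟩ := ih
      refine ⟨min c (g N), lt_min hc (hpos N), fun m hm => ?_⟩
      rcases (Nat.lt_succ_iff_lt_or_eq.1 hm) with h1 | rfl
      · exact (min_le_left _ _).trans (h m h1)
      · exact min_le_right _ _
  obtain ⟨M, hM⟩ := (hlim.eventually_lt_const hc).exists
  -- This slope is so small that `g m + σ₀ * m` is below `c` at `m = M`, which forces its minimizer
  -- `n` to be at least `N`.
  set σ₀ : ℝ := (c - g M) / (M + 1) with hσ₀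
  have hσ₀pos : 0 < σ₀ := div_pos (by linarith) (by positivity)
  have hσ₀M : g M + σ₀ * M < c := by
    have : σ₀ * (M + 1) = c - g M := by
      rw [hσ₀]
      field_simp
    linarith
  obtain ⟨n, hn⟩ : ∃ n, ∀ m, -(g m + σ₀ * m) ≤ -(g n + σ₀ * n) := by
    refine exists_forall_le_of_eventually_le (f := fun m => -(g m + σ₀ * m)) M ?_
    have : Tendsto (fun m : ℕ => σ₀ * m) atTop atTop :=
      tendsto_natCast_atTop_atTop.const_mul_atTop hσ₀pos
    filter_upwards [this.eventually_ge_atTop (g M + σ₀ * M)] with m hm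
    linarith [hpos m]
  have hnN : N ≤ n := by
    by_contra! h
    have h1 := hcg n h
    have h2 := hn M
    have h3 : 0 ≤ σ₀ * n := by positivity
    linarith
  -- The line is now turned about `(n, g n)` until it touches the graph on the right: `φ j` is the
  -- rate of descent of the chord to `n + 1 + j`, and its maximum is the new slope. It is at most
  -- `σ₀`, so the line stays below the graph on the left.
  let φ : ℕ → ℝ := fun j => (g n - g (n + 1 + j)) * (1 / ((j : ℝ) + 1))
  have hφlim : Tendsto φ atTop (𝓝 0) := by
    have h1 : Tendsto (fun j => g (n + 1 + j)) atTop (𝓝 0) :=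
      hlim.comp (tendsto_atTop_mono (fun j => Nat.le_add_left j (n + 1)) tendsto_id)
    have := (h1.const_sub (g n)).mul (tendsto_one_div_add_atTop_nhds_zero_nat (𝕜 := ℝ))
    simpa [φ] using this
  obtain ⟨j₁, hj₁⟩ : ∃ j, 0 < φ j := by
    have h1 : Tendsto (fun j => g (n + 1 + j)) atTop (𝓝 0) :=
      hlim.comp (tendsto_atTop_mono (fun j => Nat.le_add_left j (n + 1)) tendsto_id)
    obtain ⟨j, hj⟩ := (h1.eventually_lt_const (hpos n)).exists
    exact ⟨j, mul_pos (sub_pos.2 hj) (by positivity)⟩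
  obtain ⟨j, hj⟩ := exists_forall_le_of_eventually_le (f := φ) j₁
    ((hφlim.eventually_lt_const hj₁).mono fun _ h => h.le)
  have hσ : 0 < φ j := hj₁.trans_le (hj j₁)
  have heq : ∀ i : ℕ, φ i * (i + 1) = g n - g (n + 1 + i) := by
    intro i
    simp only [φ]
    field_simp
  have hle : φ j ≤ σ₀ := by
    have h1 := hn (n + 1 + j)
    push_cast at h1
    have h2 := heq j
    have h3 : φ j * (j + 1) ≤ σ₀ * (j + 1) := by linarith
    exact le_of_mul_le_mul_right h3 (by positivity)
  refine ⟨n, n + 1 + j, φ j, hnN, by omega, hσ.le, fun m => ?_, ?_⟩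
  · rcases Nat.lt_or_ge n m with hm | hm
    · obtain ⟨i, rfl⟩ := Nat.exists_eq_add_of_le (Nat.succ_le_of_lt hm)
      have h1 := heq i
      have h2 : φ i * (i + 1) ≤ φ j * (i + 1) :=
        mul_le_mul_of_nonneg_right (hj i) (by positivity)
      simp only [Nat.succ_eq_add_one]
      push_cast
      linarith
    · have h1 := hn m
      have h2 : (m : ℝ) ≤ n := by exact_mod_cast hm
      nlinarith
  · have h1 := heq j
    push_cast
    linarith

/-- A quantitative form of the strict convexity of `x ↦ x ^ (-q)`. -/
lemma midpoint_rpow_mul_gt {x y q a b l : ℝ} (hx : 0 < x) (hxy : x < y) (hq : 0 < q) (hl : 0 < l)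
    (ha : l ≤ x ^ q * a) (hb : l ≤ y ^ q * b) : l < ((x + y) / 2) ^ q * ((a + b) / 2) := by
  have hy := hx.trans hxy
  have hP : 0 < x ^ q := Real.rpow_pos_of_pos hx q
  have hR : 0 < y ^ q := Real.rpow_pos_of_pos hy q
  have hZ : 0 < ((x + y) / 2) ^ q := Real.rpow_pos_of_pos (by linarith) q
  have hPR : x ^ q * y ^ q < ((x + y) / 2) ^ q * ((x + y) / 2) ^ q := by
    rw [← Real.mul_rpow hx.le hy.le, ← Real.mul_rpow (by linarith) (by linarith)]
    refine Real.rpow_lt_rpow (by positivity) ?_ hq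
    nlinarith [sq_pos_of_pos (sub_pos.2 hxy)]
  generalize x ^ q = P at *
  generalize y ^ q = R at *
  generalize ((x + y) / 2) ^ q = Z at *
  have ha' : l / P ≤ a := by
    rw [div_le_iff₀ hP]
    linarith
  have hb' : l / R ≤ b := by
    rw [div_le_iff₀ hR]
    linarith
  -- This says that `1 / Z` is less than the mean of `1 / P` and `1 / R`. It combines `P * R < Z ^
  -- 2` with the arithmetic-geometric inequality for `P` and `R`.
  have hmain : 2 * (P * R) < Z * (P + R) := by
    refine lt_of_pow_lt_pow_left₀ 2 (by positivity) ?_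
    have h1 : 4 * (P * R) ≤ (P + R) ^ 2 := by nlinarith [sq_nonneg (P - R)]
    calc (2 * (P * R)) ^ 2 = P * R * (4 * (P * R)) := by ring
      _ < Z * Z * (4 * (P * R)) := mul_lt_mul_of_pos_right hPR (by positivity)
      _ ≤ Z * Z * (P + R) ^ 2 := by gcongr
      _ = (Z * (P + R)) ^ 2 := by ring
  calc l = l * (2 * (P * R)) / (2 * (P * R)) := by field_simp
    _ < l * (Z * (P + R)) / (2 * (P * R)) := by gcongr
    _ = Z * ((l / P + l / R) / 2) := by
        field_simp
        ring
    _ ≤ Z * ((a + b) / 2) := by gcongr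

/-! ### Renormalized errors and the absence of a limit. -/

lemma two_rpow_div_dim (p : ℝ) : (2 : ℝ) ^ (p / (Real.log 2 / Real.log 3)) = 3 ^ p := by
  rw [← three_rpow_log_two_div_log_three, ← Real.rpow_mul (by norm_num),
    three_rpow_log_two_div_log_three, mul_div_cancel₀ _ log_two_div_log_three_pos.ne']

lemma inv_three_rpow_mul_two_rpow (p : ℝ) (k : ℕ) (x : ℝ) (hx : 0 ≤ x) :
    ((3⁻¹ : ℝ) ^ p) ^ k * (2 ^ k * x) ^ (p / (Real.log 2 / Real.log 3)) =
      x ^ (p / (Real.log 2 / Real.log 3)) := by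
  rw [Real.mul_rpow (by positivity) hx, ← mul_assoc]
  rw [← Real.rpow_natCast 2 k, ← Real.rpow_mul (by norm_num), mul_comm (k : ℝ),
    Real.rpow_mul (by norm_num), two_rpow_div_dim, Real.rpow_natCast, ← mul_pow,
    ← Real.mul_rpow (by norm_num) (by norm_num)]
  norm_num

lemma natCast_rpow_eq_ofReal {q : ℝ} (hq : 0 ≤ q) (N : ℕ) :
    (N : ℝ≥0∞) ^ q = ENNReal.ofReal ((N : ℝ) ^ q) := by
  rw [← ENNReal.ofReal_rpow_of_nonneg (Nat.cast_nonneg N) hq, ENNReal.ofReal_natCast]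

lemma quantErr_scaled_two_pow_le {p : ℝ} (hp : 0 ≤ p) (k N : ℕ) :
    quantErr p cantorMeasure (2 ^ k * N) *
        ((2 ^ k * N : ℕ) : ℝ≥0∞) ^ (p / (Real.log 2 / Real.log 3)) ≤
      quantErr p cantorMeasure N * (N : ℝ≥0∞) ^ (p / (Real.log 2 / Real.log 3)) := by
  have hq : 0 ≤ p / (Real.log 2 / Real.log 3) := div_nonneg hp log_two_div_log_three_pos.le
  calc _ ≤ (3⁻¹ ^ p) ^ k * quantErr p cantorMeasure N *
        ((2 ^ k * N : ℕ) : ℝ≥0∞) ^ (p / (Real.log 2 / Real.log 3)) := by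
        gcongr
        exact quantErr_two_pow_mul_le hp k N
    _ = quantErr p cantorMeasure N * ENNReal.ofReal (((3⁻¹ : ℝ) ^ p) ^ k *
        (2 ^ k * N) ^ (p / (Real.log 2 / Real.log 3))) := by
        rw [natCast_rpow_eq_ofReal hq, ENNReal.ofReal_mul (by positivity),
          ENNReal.ofReal_pow (by positivity), ofReal_inv_three_rpow]
        push_cast
        ring
    _ = _ := by
        rw [inv_three_rpow_mul_two_rpow _ _ _ (Nat.cast_nonneg N), natCast_rpow_eq_ofReal hq]

lemma not_tendsto_quantErr {p : ℝ} (hp : 0 < p) (l : ℝ≥0∞) :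
    ¬ Tendsto (fun N : ℕ => quantErr p cantorMeasure N *
      (N : ℝ≥0∞) ^ (p / (Real.log 2 / Real.log 3))) atTop (𝓝 l) := by
  intro hl
  set q := p / (Real.log 2 / Real.log 3) with hqdef
  have hq : 0 < q := div_pos hp log_two_div_log_three_pos
  have hsub : ∀ N : ℕ, 1 ≤ N → Tendsto (fun k : ℕ => 2 ^ k * N) atTop atTop := fun N hN =>
    tendsto_atTop_mono (fun k => (Nat.lt_two_pow_self).le.trans (Nat.le_mul_of_pos_right _ hN))
      tendsto_id
  have hupper : ∀ N : ℕ, 1 ≤ N → l ≤ quantErr p cantorMeasure N * (N : ℝ≥0∞) ^ q := fun N hN =>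
    le_of_tendsto' (hl.comp (hsub N hN)) fun k => quantErr_scaled_two_pow_le hp.le k N
  have hfin : ∀ N : ℕ, 1 ≤ N → quantErr p cantorMeasure N ≠ ∞ := fun N hN =>
    (((quantErr_anti p _ hN).trans (quantErr_one_le hp.le)).trans_lt ENNReal.one_lt_top).ne
  have hltop : l ≠ ∞ := by
    refine ((hupper 1 le_rfl).trans_lt ?_).ne
    simpa using (hfin 1 le_rfl).lt_top
  have hgfin : ∀ N : ℕ, guardedErr p N ≠ ∞ := by
    intro N
    have hle : guardedErr p N ≤ cantorCost p ({-1 / 2} : Finset ℝ) :=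
      (iInf₂_le ∅ (by simp)).trans (cantorCost_anti hp.le (by simp [guardPoints]))
    refine (hle.trans_lt ?_).ne
    calc cantorCost p ({-1 / 2} : Finset ℝ) ≤ ∫⁻ _, 2 ^ p ∂cantorMeasure := by
          refine lintegral_mono_ae ?_
          filter_upwards [ae_cantorMeasure_mem_Icc] with x hx
          refine ENNReal.rpow_le_rpow ?_ hp.le
          rw [Finset.coe_singleton, Metric.infEDist_singleton, edist_dist, Real.dist_eq,
            abs_of_nonneg (by linarith [hx.1])]
          refine ENNReal.ofReal_le_of_le_toReal ?_
          simp only [ENNReal.toReal_ofNat]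
          linarith [hx.2]
      _ < ∞ := by
          rw [lintegral_const, measure_univ, mul_one]
          exact ENNReal.rpow_lt_top_of_nonneg hp.le (by simp)
  let g : ℕ → ℝ := fun N => (guardedErr p N).toReal
  have hgpos : ∀ n, 0 < g n := fun n => ENNReal.toReal_pos (guardedErr_pos hp n).ne' (hgfin n)
  have hglim : Tendsto g atTop (𝓝 0) := by
    have h0 : Tendsto (guardedErr p) atTop (𝓝 0) :=
      tendsto_of_tendsto_of_tendsto_of_le_of_le tendsto_const_nhds (tendsto_quantErr hp)
        (fun _ => bot_le) fun N => guardedErr_le_quantErr hp.le N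
    simpa [g, Function.comp_def] using (ENNReal.tendsto_toReal ENNReal.zero_ne_top).comp h0
  have hδ : 0 < ENNReal.ofReal (1 / 4) ^ p * 2⁻¹ ^ 2 :=
    ENNReal.mul_pos
      (ENNReal.rpow_pos (ENNReal.ofReal_pos.2 (by norm_num)) ENNReal.ofReal_ne_top).ne'
      (by simp)
  obtain ⟨N₀, hN₀⟩ := eventually_atTop.1 ((tendsto_quantErr hp).eventually_lt_const hδ)
  obtain ⟨n, n', σ, hn, hnn', hσ, hline, hn'⟩ := exists_supporting_line hgpos hglim (max N₀ 1)
  have hn1 : 1 ≤ n := (le_max_right _ _).trans hn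
  have hreal : ∀ N : ℕ, max N₀ 1 ≤ N → l.toReal ≤ (N : ℝ) ^ q * g N := by
    intro N hN
    have h1 := hupper N ((le_max_right _ _).trans hN)
    have h2 := quantErr_le_guardedErr_of_lt hp.le (hN₀ N ((le_max_left _ _).trans hN))
    have h3 := h1.trans (mul_le_mul_left h2 _)
    rw [natCast_rpow_eq_ofReal hq.le] at h3
    have h4 := ENNReal.toReal_mono (ENNReal.mul_ne_top (hgfin N) ENNReal.ofReal_ne_top) h3
    rwa [ENNReal.toReal_mul, ENNReal.toReal_ofReal (by positivity), mul_comm] at h4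
  -- The supporting line takes the value `(g n + g n') / 2` at the midpoint. The midpoint may be a
  -- half-integer, so the line is rescaled `k + 1` times and used at `2 ^ k * (n + n')`.
  have hlower : ((n + n' : ℝ) / 2) ^ q * ((g n + g n') / 2) ≤ l.toReal := by
    rw [← ENNReal.ofReal_le_iff_le_toReal hltop]
    refine ge_of_tendsto' (hl.comp (hsub (n + n') (by omega))) fun k => ?_
    have h1 := affine_le_guardedErr_div_pow hp.le hσ (α := g n + σ * n) (fun m => by
      rw [ENNReal.ofReal_le_iff_le_toReal (hgfin m)]
      have := hline m
      simp only [g] at this ⊢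
      linarith) (k + 1) (2 ^ k * (n + n'))
    have h2 := mul_le_mul_left (h1.trans (guardedErr_le_quantErr hp.le _))
      (((2 ^ k * (n + n') : ℕ) : ℝ≥0∞) ^ q)
    refine le_trans (le_of_eq ?_) h2
    have hval : g n + σ * n - σ / 2 ^ (k + 1) * ((2 ^ k * (n + n') : ℕ) : ℝ) =
        (g n + g n') / 2 := by
      rw [hn', pow_succ]
      push_cast
      field_simp
      ring
    have hcast : ((2 ^ k * (n + n') : ℕ) : ℝ) = 2 ^ (k + 1) * ((n + n' : ℝ) / 2) := by
      rw [pow_succ]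
      push_cast
      ring
    have hnn : 0 ≤ (3⁻¹ ^ p) ^ (k + 1) * ((g n + g n') / 2) := by
      have := hgpos n
      have := hgpos n'
      positivity
    rw [hval, natCast_rpow_eq_ofReal hq.le, ← ENNReal.ofReal_mul hnn, hcast, mul_right_comm,
      inv_three_rpow_mul_two_rpow _ _ _ (by positivity)]
  have hxpos : (0 : ℝ) < n := by exact_mod_cast hn1
  have hlpos : 0 < l.toReal := by
    refine lt_of_lt_of_le ?_ hlower
    have := hgpos n
    have := hgpos n'
    positivity
  exact (midpoint_rpow_mul_gt hxpos (by exact_mod_cast hnn') hq hlpos (hreal n hn)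
    (hreal n' (hn.trans hnn'.le))).not_ge hlower

theorem theorem3 :
    ∃ κ : Measure ℝ,
      (IsDyadicCantorMeasure κ ∧ ∀ κ' : Measure ℝ, IsDyadicCantorMeasure κ' → κ' = κ) ∧
      IsAhlforsRegular (Real.log 2 / Real.log 3) κ ∧
      ∀ p : ℝ, 1 ≤ p →
        ¬ ∃ L : ℝ≥0∞,
          Tendsto (fun N : ℕ =>
              quantizationDist p κ N * (N : ℝ≥0∞) ^ (1 / (Real.log 2 / Real.log 3)))
            atTop (𝓝 L) := by
  refine ⟨cantorMeasure, ⟨isDyadicCantorMeasure_cantorMeasure, fun κ' h =>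
    h.unique isDyadicCantorMeasure_cantorMeasure⟩, isAhlforsRegular_cantorMeasure, ?_⟩
  rintro p hp ⟨L, hL⟩
  have hp0 : 0 < p := by linarith
  -- Taking `p`-th powers is continuous on `[0, ∞]`, so an infinite limit is covered too.
  refine not_tendsto_quantErr hp0 (L ^ p) ?_
  have := ((ENNReal.continuous_rpow_const (y := p)).tendsto L).comp hL
  refine this.congr fun N => ?_
  rw [Function.comp_apply, ENNReal.mul_rpow_of_nonneg _ _ hp0.le, quantizationDist_rpow hp0,
    ← ENNReal.rpow_mul, one_div_mul_eq_div]
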